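/- Let $p\ge 1$ be fixed and let $y=X\beta^*+\varepsilon$ with $\beta^*\in\mathbb R^p$, deterministic designs $X=X_n\in\mathbb R^{n\times p}$ with rows $x_i$, and $\varepsilon_1,\dots,\varepsilon_n$ i.i.d. $\mathcal N(0,\sigma^2)$, $\sigma>0$. Assume that, as $n\to\infty$, $\frac1n X^\top X\to C$ with $C$ positive definite and $\frac1n\max_i\|x_i\|_2^2\to 0$. Let $m=m_n$ be positive integers (for all large $n$) with $n/m\to r_0\ge 0$, and let $\tilde\beta=\tilde\beta_n$ be an initial estimator, independent of $\varepsilon$, such that $\sqrt m(\tilde\beta-\beta^*)$ converges in distribution to some probability law $\nu$ on $\mathbb R^p$. For $\lambda_n,\eta_n\ge 0$ let $\hat\beta_n$ be a Transfer Lasso estimator, that is, a (measurable) minimiser over $\beta\in\mathbb R^p$ of $$\frac1n\|y-X\beta\|_2^2+\frac{\lambda_n}{n}\sum_j|\beta_j|+\frac{\eta_n}{n}\sum_j|\beta_j-\tilde\beta_j|.$$ Say that the convergence rate of $\hat\beta_n$ is at least $a_n$ if $a_n(\hat\beta_n-\beta^*)$ converges in distribution to some probability law; that it is (exactly) $a_n$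 if moreover this law is not the point mass $\delta_0$ at $0$; and that it is faster than $a_n$ if $a_n(\hat\beta_n-\beta^*)\to 0$ in probability. Then: (i) If $\eta_n/\sqrt n\to\infty$ and $\lambda_n/\eta_n\to\rho_0$ with $0\le\rho_0<1$, then the convergence rate is at least $\sqrt m$, and it is exactly $\sqrt m$ if $\nu\ne\delta_0$. (ii) If $\lambda_n/\sqrt n\to\lambda_0\ge0$ and $\eta_n/\sqrt n\to\eta_0\ge0$, then the convergence rate is exactly $\sqrt n$. (iii) Let $\lambda_n/\sqrt n\to\infty$, $\lambda_n/n\to0$ and $\eta_n/\lambda_n\to\rho_0'\ge 0$. If $\rho_0'<1$, then the convergence rate is at least $n/\lambda_n$, where $n/\lambda_n=o(\sqrt n)$; if moreover $\beta^*\neq0$, then it is exactly $n/\lambda_n$, and it is slower than $\sqrt n$ in the sense that $\sqrt n(\hat\beta_n-\beta^*)$ is not bounded in probability. If $\rho_0'\ge1$, then the convergence rate is faster than $n/\lambda_n$. -/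

import Mathlib

open Filter Topology MeasureTheory ProbabilityTheory
open scoped Matrix NNReal

noncomputable section

/-- The Transfer Lasso objective
`(1/n) ‖y - X β‖₂² + (lam/n) ∑ⱼ |βⱼ| + (eta/n) ∑ⱼ |βⱼ - β₀ⱼ|`,
with source (initial) parameter `β₀`. -/
def transferLassoObjective {n p : ℕ} (X : Matrix (Fin n) (Fin p) ℝ) (y : Fin n → ℝ)
    (lam eta : ℝ) (β₀ β : EuclideanSpace ℝ (Fin p)) : ℝ :=
  (1 / (n : ℝ)) * ∑ i, (y i - (X *ᵥ β.ofLp) i) ^ 2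
    + (lam / n) * ∑ j, |β j| + (eta / n) * ∑ j, |β j - β₀ j|

/-- `β` is a Transfer Lasso estimate: a global minimiser of the objective. -/
def IsTransferLasso {n p : ℕ} (X : Matrix (Fin n) (Fin p) ℝ) (y : Fin n → ℝ)
    (lam eta : ℝ) (β₀ β : EuclideanSpace ℝ (Fin p)) : Prop :=
  IsMinOn (transferLassoObjective X y lam eta β₀) Set.univ β

/-- The design condition: the Gram matrices `(1/n) XᵀX` converge to a positive definite
matrix, and `(1/n) maxᵢ ‖xᵢ‖₂² → 0`, where `xᵢ` are the rows of the `n × p` design `X n`. -/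
def DesignCondition {p : ℕ} (X : (n : ℕ) → Matrix (Fin n) (Fin p) ℝ) : Prop :=
  (∃ C : Matrix (Fin p) (Fin p) ℝ, C.PosDef ∧
    Tendsto (fun n : ℕ => (1 / (n : ℝ)) • ((X n)ᵀ * X n)) atTop (𝓝 C)) ∧
  Tendsto (fun n : ℕ => (1 / (n : ℝ)) * ⨆ i : Fin n, ∑ j, (X n i j) ^ 2) atTop (𝓝 0)

section Rates

variable {Ω E : Type*} [MeasurableSpace Ω] [NormedAddCommGroup E] [NormedSpace ℝ E]
  [MeasurableSpace E] [BorelSpace E]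

/-- `a n • err n` converges in distribution to some probability law (possibly the point
mass at `0`): the estimation error is of order at most `1 / a n`. -/
def ConvergesAtRate (P : Measure Ω) [IsProbabilityMeasure P] (err : ℕ → Ω → E)
    (a : ℕ → ℝ) : Prop :=
  ∃ L : ProbabilityMeasure E,
    TendstoInDistribution (fun n ω => a n • err n ω) atTop id (fun _ => P) (L : Measure E)

/-- The convergence rate is (exactly) `a n`: `a n • err n` converges in distribution to a
probability law which is not the point mass at `0`. -/
def HasConvergenceRate (P : Measure Ω) [IsProbabilityMeasure P] (err : ℕ → Ω → E)
    (a : ℕ → ℝ) : Prop :=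
  ∃ L : ProbabilityMeasure E,
    TendstoInDistribution (fun n ω => a n • err n ω) atTop id (fun _ => P) (L : Measure E) ∧
    (L : Measure E) ≠ Measure.dirac 0

/-- The convergence rate is faster than `a n`: `a n • err n → 0` in probability. -/
def HasRateFasterThan (P : Measure Ω) (err : ℕ → Ω → E) (a : ℕ → ℝ) : Prop :=
  TendstoInMeasure P (fun n ω => a n • err n ω) atTop (fun _ => 0)

/-- `Y n = O_P(1)`. -/
def IsBoundedInProbability (P : Measure Ω) (Y : ℕ → Ω → E) : Prop :=
  ∀ δ : ℝ, 0 < δ → ∃ K : ℝ, ∀ᶠ n in atTop, P.real {ω | K < ‖Y n ω‖} ≤ δ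

end Rates

end

/-! ### Quadratic growth and the local objective -/

noncomputable section

open scoped RealInnerProductSpace

/-! In the local parameter `u = s • (β - βstar)` the objective, up to a constant and the factor
`s⁻²`, is a coercive quadratic with linear term `(s / √n) • W`, where `W = n^{-1/2} Xᵀ ε`, plus a
lasso increment of weight `lam * s / n` and an `ℓ¹` penalty of weight `eta * s / n` centred at `s •
(βinit - βstar)`. The regimes differ only in the scale: `s = √m` in (i), `√n` in (ii), `n / lam` in
(iii).

The random inputs `W` and `√m • (βinit - βstar)` converge jointly to a product law. Rather than
passing to a limit of random functions, the proof compares two minimisers at the same input: that of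
the finite-`n` objective and that of the limit objective. Quadratic growth makes their distance
small, deterministically and uniformly over bounded inputs (`eventually_norm_sub_lt_of_minimisers`).
The limit minimiser is a continuous function `F` of the input, so tightness, continuous mapping and
Slutsky give the limit law (`tendstoInDistribution_smul_transferLasso`).

In (i) the centred penalty dominates and the minimiser is exactly its centre on bounded inputs, so
the error inherits `ν`. In (ii) a limit concentrated at zero would force the Gaussian score to be
bounded. In (iii) the inputs are scaled away and the limit is a constant, which vanishes if `ρ₀' ≥
1` and is nonzero if `ρ₀' < 1` and `βstar ≠ 0`. -/

/-- Strong growth of a convexly penalised coercive quadratic function at its minimiser. -/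
lemma quadratic_growth_of_isMinOn {E : Type*} [NormedAddCommGroup E] [InnerProductSpace ℝ E]
    {A : E →L[ℝ] E} {c : ℝ} (hA : ∀ v, c * ‖v‖ ^ 2 ≤ ⟪A v, v⟫) {w : E} {h : E → ℝ}
    (hh : ConvexOn ℝ Set.univ h) {u₀ : E}
    (hu : ∀ u, ⟪A u₀, u₀⟫ - 2 * ⟪w, u₀⟫ + h u₀ ≤ ⟪A u, u⟫ - 2 * ⟪w, u⟫ + h u) (u : E) :
    c * ‖u - u₀‖ ^ 2 ≤
      (⟪A u, u⟫ - 2 * ⟪w, u⟫ + h u) - (⟪A u₀, u₀⟫ - 2 * ⟪w, u₀⟫ + h u₀) := by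
  set F := (⟪A u, u⟫ - 2 * ⟪w, u⟫ + h u) - (⟪A u₀, u₀⟫ - 2 * ⟪w, u₀⟫ + h u₀) with hF
  -- Compare `u₀` with `(1 - t) u₀ + t u`: convexity of `h` and the expansion of the quadratic form,
  -- which needs no symmetry of `A`, leave this bound after division by `t`. Then let `t → 0`.
  have key : ∀ t : ℝ, 0 < t → t < 1 → (1 - t) * ⟪A (u - u₀), u - u₀⟫ ≤ F := by
    intro t ht ht1
    have h1 := hu ((1 - t) • u₀ + t • u)
    have h2 := hh.2 (Set.mem_univ u₀) (Set.mem_univ u) (by linarith : 0 ≤ 1 - t) ht.le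
      (by ring)
    simp only [smul_eq_mul] at h2
    simp only [map_add, map_smul, inner_add_left, inner_add_right, inner_smul_left,
      inner_smul_right, RCLike.conj_to_real] at h1
    have h3 : 0 ≤ t * (F - (1 - t) * ⟪A (u - u₀), u - u₀⟫) := by
      simp only [map_sub, inner_sub_left, inner_sub_right, hF]
      nlinarith
    nlinarith [(mul_nonneg_iff_of_pos_left ht).1 h3]
  have hlim : Tendsto (fun t : ℝ => (1 - t) * ⟪A (u - u₀), u - u₀⟫) (𝓝[>] 0)
      (𝓝 ((1 - 0) * ⟪A (u - u₀), u - u₀⟫)) :=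
    ((continuous_const.sub continuous_id).mul continuous_const).continuousWithinAt
  have := le_of_tendsto hlim (by
    filter_upwards [Ioo_mem_nhdsGT (zero_lt_one' ℝ)] with t ht using key t ht.1 ht.2)
  rw [sub_zero, one_mul] at this
  exact (hA _).trans this

/-- The rescaled objective of a penalised least squares problem in the local parameter `u`. -/
def localObjective {p : ℕ} (A : EuclideanSpace ℝ (Fin p) →L[ℝ] EuclideanSpace ℝ (Fin p))
    (φ : Fin p → ℝ → ℝ) (a b : ℝ) (w d u : EuclideanSpace ℝ (Fin p)) : ℝ :=
  ⟪A u, u⟫ - 2 * ⟪w, u⟫ + (a * ∑ j, φ j (u j) + b * ∑ j, |u j - d j|)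

/-- Coordinatewise penalties that are convex, `1`-Lipschitz and vanish at the origin. -/
structure IsPenalty {p : ℕ} (φ : Fin p → ℝ → ℝ) : Prop where
  convex : ∀ j, ConvexOn ℝ Set.univ (φ j)
  abs_sub_le : ∀ j x y, |φ j x - φ j y| ≤ |x - y|
  map_zero : ∀ j, φ j 0 = 0

namespace IsPenalty

variable {p : ℕ} {φ : Fin p → ℝ → ℝ}

lemma abs_le (hφ : IsPenalty φ) (j : Fin p) (x : ℝ) : |φ j x| ≤ |x| := by
  simpa [hφ.map_zero] using hφ.abs_sub_le j x 0

lemma continuous (hφ : IsPenalty φ) (j : Fin p) : Continuous (φ j) :=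
  (LipschitzWith.of_dist_le_mul (K := 1) fun x y => by
    simpa [Real.dist_eq] using hφ.abs_sub_le j x y).continuous

end IsPenalty

/-! ### Norm comparisons and convexity of the penalties -/

section Coordinates

variable {p : ℕ}

lemma EuclideanSpace.abs_apply_le (u : EuclideanSpace ℝ (Fin p)) (j : Fin p) : |u j| ≤ ‖u‖ := by
  simpa using PiLp.norm_apply_le u j

lemma EuclideanSpace.sum_abs_le (u : EuclideanSpace ℝ (Fin p)) : ∑ j, |u j| ≤ p * ‖u‖ := by
  simpa using Finset.sum_le_sum fun j (_ : j ∈ Finset.univ) => u.abs_apply_le j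

lemma EuclideanSpace.norm_le_sum_abs (u : EuclideanSpace ℝ (Fin p)) : ‖u‖ ≤ ∑ j, |u j| := by
  rw [EuclideanSpace.norm_eq]
  refine Real.sqrt_le_iff.2 ⟨by positivity, ?_⟩
  simpa using Finset.sum_sq_le_sq_sum_of_nonneg (s := Finset.univ) (f := fun j => |u j|)
    fun j _ => abs_nonneg _

lemma IsPenalty.abs_sum_sub_le {φ : Fin p → ℝ → ℝ} (hφ : IsPenalty φ)
    (u v : EuclideanSpace ℝ (Fin p)) :
    |∑ j, φ j (u j) - ∑ j, φ j (v j)| ≤ ∑ j, |(u - v) j| := by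
  rw [← Finset.sum_sub_distrib]
  exact (Finset.abs_sum_le_sum_abs _ _).trans (Finset.sum_le_sum fun j _ => hφ.abs_sub_le j _ _)

lemma abs_sum_abs_sub_sub_le (u v d : EuclideanSpace ℝ (Fin p)) :
    |(∑ j, |u j - d j|) - (∑ j, |v j - d j|)| ≤ ∑ j, |(u - v) j| := by
  rw [← Finset.sum_sub_distrib]
  refine (Finset.abs_sum_le_sum_abs _ _).trans (Finset.sum_le_sum fun j _ => ?_)
  simpa using abs_abs_sub_abs_le (u j - d j) (v j - d j)

lemma convexOn_penalty {φ : Fin p → ℝ → ℝ} (hφ : IsPenalty φ) {a b : ℝ} (ha : 0 ≤ a)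
    (hb : 0 ≤ b) (d : EuclideanSpace ℝ (Fin p)) :
    ConvexOn ℝ Set.univ fun u : EuclideanSpace ℝ (Fin p) =>
      a * ∑ j, φ j (u j) + b * ∑ j, |u j - d j| := by
  refine ⟨convex_univ, fun u _ v _ s t hs ht hst => ?_⟩
  have h1 : ∑ j, φ j ((s • u + t • v) j) ≤ s * ∑ j, φ j (u j) + t * ∑ j, φ j (v j) := by
    rw [Finset.mul_sum, Finset.mul_sum, ← Finset.sum_add_distrib]
    exact Finset.sum_le_sum fun j _ =>
      (hφ.convex j).2 (Set.mem_univ (u j)) (Set.mem_univ (v j)) hs ht hst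
  have h2 : ∑ j, |(s • u + t • v) j - d j| ≤
      s * ∑ j, |u j - d j| + t * ∑ j, |v j - d j| := by
    rw [Finset.mul_sum, Finset.mul_sum, ← Finset.sum_add_distrib]
    refine Finset.sum_le_sum fun j _ => ?_
    have : (s • u + t • v) j - d j = s * (u j - d j) + t * (v j - d j) := by
      simp only [PiLp.add_apply, PiLp.smul_apply, smul_eq_mul]
      linear_combination (d j) * hst
    rw [this]
    refine (abs_add_le _ _).trans ?_
    rw [abs_mul, abs_mul, abs_of_nonneg hs, abs_of_nonneg ht]
  have h3 := mul_le_mul_of_nonneg_left h1 ha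
  have h4 := mul_le_mul_of_nonneg_left h2 hb
  simp only [smul_eq_mul]
  linarith

end Coordinates

/-! ### Growth, stability and continuity of local minimisers -/

section LocalObjective

variable {p : ℕ} {A A' : EuclideanSpace ℝ (Fin p) →L[ℝ] EuclideanSpace ℝ (Fin p)}
  {φ φ' : Fin p → ℝ → ℝ} {a a' b b' c : ℝ} {w w' d d' u u' : EuclideanSpace ℝ (Fin p)}

lemma localObjective_growth (hA : ∀ v, c * ‖v‖ ^ 2 ≤ ⟪A v, v⟫) (hφ : IsPenalty φ)
    (ha : 0 ≤ a) (hb : 0 ≤ b) (hu : ∀ v, localObjective A φ a b w d u ≤ localObjective A φ a b w d v)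
    (v : EuclideanSpace ℝ (Fin p)) :
    c * ‖v - u‖ ^ 2 ≤ localObjective A φ a b w d v - localObjective A φ a b w d u :=
  quadratic_growth_of_isMinOn hA (convexOn_penalty hφ ha hb d) hu v

/-- The penalties are Lipschitz, so measuring against the value at `0` removes all dependence on the
centre `d`. The resulting a priori bounds need no control of `d`. -/
lemma localObjective_lower_bound (hA : ∀ v, c * ‖v‖ ^ 2 ≤ ⟪A v, v⟫) (hφ : IsPenalty φ)
    (ha : 0 ≤ a) (hb : 0 ≤ b) :
    c * ‖u‖ ^ 2 - (2 * ‖w‖ + (a + b) * p) * ‖u‖ ≤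
      localObjective A φ a b w d u - localObjective A φ a b w d 0 := by
  have h1 := hA u
  have h2 := real_inner_le_norm w u
  have h3 := (abs_le.1 (hφ.abs_sum_sub_le u 0)).1
  have h4 := (abs_le.1 (abs_sum_abs_sub_sub_le u 0 d)).1
  rw [sub_zero] at h3 h4
  have h5 := u.sum_abs_le
  have h6 := mul_le_mul_of_nonneg_left (h3.trans' (neg_le_neg h5)) ha
  have h7 := mul_le_mul_of_nonneg_left (h4.trans' (neg_le_neg h5)) hb
  simp only [localObjective, map_zero, inner_zero_right]
  linarith

lemma norm_le_of_forall_localObjective_le (hc : 0 < c) (hA : ∀ v, c * ‖v‖ ^ 2 ≤ ⟪A v, v⟫)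
    (hφ : IsPenalty φ) (ha : 0 ≤ a) (hb : 0 ≤ b)
    (hu : ∀ v, localObjective A φ a b w d u ≤ localObjective A φ a b w d v) :
    ‖u‖ ≤ (2 * ‖w‖ + (a + b) * p) / c := by
  have h1 := localObjective_lower_bound (u := u) (w := w) (d := d) hA hφ ha hb
  have h2 := hu 0
  rw [le_div_iff₀ hc]
  rcases (norm_nonneg u).eq_or_lt with h | h
  · rw [← h, zero_mul]; positivity
  · by_contra! hlt
    nlinarith

lemma continuous_localObjective (hφ : IsPenalty φ) :
    Continuous (localObjective A φ a b w d) := by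
  have := hφ.continuous
  unfold localObjective
  fun_prop

lemma exists_forall_localObjective_le (hc : 0 < c) (hA : ∀ v, c * ‖v‖ ^ 2 ≤ ⟪A v, v⟫)
    (hφ : IsPenalty φ) (ha : 0 ≤ a) (hb : 0 ≤ b) (w d : EuclideanSpace ℝ (Fin p)) :
    ∃ u, ∀ v, localObjective A φ a b w d u ≤ localObjective A φ a b w d v := by
  refine (continuous_localObjective hφ).exists_forall_le ?_
  set B := 2 * ‖w‖ + (a + b) * p
  have h1 : Tendsto (fun x : ℝ => x * (c * x - B) + localObjective A φ a b w d 0) atTop atTop :=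
    tendsto_atTop_add_const_right _ _ (tendsto_id.atTop_mul_atTop₀
      (tendsto_atTop_add_const_right _ _ (tendsto_id.const_mul_atTop hc)))
  refine tendsto_atTop_mono (fun u => ?_) (h1.comp tendsto_norm_cocompact_atTop)
  have := localObjective_lower_bound (u := u) (w := w) (d := d) hA hφ ha hb
  simp only [Function.comp_apply]
  linarith

/-- Growth at `u`, tested at `u'`, is added to minimality of `u'`, tested at `u`; only the
differences of the coefficients survive. Agreement of the penalties on `[-R, R]` suffices because
both minimisers lie in that ball. -/
lemma localObjective_stability (hA : ∀ v, c * ‖v‖ ^ 2 ≤ ⟪A v, v⟫) (hφ : IsPenalty φ)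
    (ha : 0 ≤ a) (hb : 0 ≤ b) (hu : ∀ v, localObjective A φ a b w d u ≤ localObjective A φ a b w d v)
    (hu' : ∀ v, localObjective A' φ' a' b' w d u' ≤ localObjective A' φ' a' b' w d v)
    {R : ℝ} (huR : ‖u‖ ≤ R) (huR' : ‖u'‖ ≤ R)
    (hφφ' : ∀ j x, |x| ≤ R → φ' j x = φ j x) :
    c * ‖u' - u‖ ^ 2 ≤ 2 * ‖A - A'‖ * R ^ 2 + (|a - a'| + |b - b'|) * (p * (2 * R)) := by
  have h1 := localObjective_growth hA hφ ha hb hu u'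
  have h2 := hu' u
  have e1 : ∑ j, φ' j (u j) = ∑ j, φ j (u j) :=
    Finset.sum_congr rfl fun j _ => hφφ' j _ ((u.abs_apply_le j).trans huR)
  have e2 : ∑ j, φ' j (u' j) = ∑ j, φ j (u' j) :=
    Finset.sum_congr rfl fun j _ => hφφ' j _ ((u'.abs_apply_le j).trans huR')
  have hR : 0 ≤ R := (norm_nonneg u).trans huR
  have hd : ∑ j, |(u' - u) j| ≤ p * (2 * R) := by
    refine (u' - u).sum_abs_le.trans (mul_le_mul_of_nonneg_left ?_ (Nat.cast_nonneg p))
    linarith [norm_sub_le u' u]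
  have hq : ∀ v, ‖v‖ ≤ R → |⟪(A - A') v, v⟫| ≤ ‖A - A'‖ * R ^ 2 := fun v hv => by
    calc |⟪(A - A') v, v⟫| ≤ ‖(A - A') v‖ * ‖v‖ := abs_real_inner_le_norm _ _
      _ ≤ ‖A - A'‖ * R * R := by
        gcongr
        exact (ContinuousLinearMap.le_opNorm _ _).trans (by gcongr)
      _ = _ := by ring
  have h3 := (abs_le.1 (hq u huR)).1
  have h4 := (abs_le.1 (hq u' huR')).2
  have h5 : (a - a') * (∑ j, φ j (u' j) - ∑ j, φ j (u j)) ≤ |a - a'| * (p * (2 * R)) := by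
    refine (le_abs_self _).trans ?_
    rw [abs_mul]
    gcongr
    exact (hφ.abs_sum_sub_le _ _).trans hd
  have h6 : (b - b') * (∑ j, |u' j - d j| - ∑ j, |u j - d j|) ≤ |b - b'| * (p * (2 * R)) := by
    refine (le_abs_self _).trans ?_
    rw [abs_mul]
    gcongr
    exact (abs_sum_abs_sub_sub_le _ _ _).trans hd
  simp only [localObjective, e1, e2] at h1 h2
  simp only [sub_apply, inner_sub_left] at h3 h4
  linarith

lemma localObjective_minimiser_modulus (hc : 0 < c) (hA : ∀ v, c * ‖v‖ ^ 2 ≤ ⟪A v, v⟫)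
    (hφ : IsPenalty φ) (ha : 0 ≤ a) (hb : 0 ≤ b)
    (hu : ∀ v, localObjective A φ a b w d u ≤ localObjective A φ a b w d v)
    (hu' : ∀ v, localObjective A φ a b w' d' u' ≤ localObjective A φ a b w' d' v) :
    c / 2 * ‖u' - u‖ ^ 2 ≤ 2 / c * ‖w' - w‖ ^ 2 + 2 * b * p * ‖d' - d‖ := by
  have h1 := localObjective_growth hA hφ ha hb hu u'
  have h2 := hu' u
  have h3 : ⟪w' - w, u' - u⟫ ≤ ‖w' - w‖ * ‖u' - u‖ := real_inner_le_norm _ _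
  have h4 : ∀ v : EuclideanSpace ℝ (Fin p),
      |(∑ j, |v j - d j|) - (∑ j, |v j - d' j|)| ≤ p * ‖d' - d‖ := fun v => by
    have := abs_sum_abs_sub_sub_le d d' v
    simp only [abs_sub_comm _ (v _)] at this
    exact this.trans ((d - d').sum_abs_le.trans_eq (by rw [norm_sub_rev]))
  have h5 := mul_le_mul_of_nonneg_left (abs_le.1 (h4 u)).1 hb
  have h6 := mul_le_mul_of_nonneg_left (abs_le.1 (h4 u')).2 hb
  -- Young's inequality, weighted so that half of the quadratic growth absorbs the cross term.
  have h7 : 2 * (‖w' - w‖ * ‖u' - u‖) ≤ 2 / c * ‖w' - w‖ ^ 2 + c / 2 * ‖u' - u‖ ^ 2 := by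
    have : 0 ≤ (c / 2) * (‖u' - u‖ - 2 / c * ‖w' - w‖) ^ 2 := by positivity
    have e : (c / 2) * (‖u' - u‖ - 2 / c * ‖w' - w‖) ^ 2 =
      c / 2 * ‖u' - u‖ ^ 2 - 2 * (‖w' - w‖ * ‖u' - u‖) + 2 / c * ‖w' - w‖ ^ 2 := by
      field_simp; ring
    linarith
  simp only [localObjective] at h1 h2
  simp only [inner_sub_left, inner_sub_right] at h3
  linarith

/-- The minimiser of the local objective depends continuously on its linear term and centre. -/
lemma exists_continuous_localObjective_minimiser (hc : 0 < c)
    (hA : ∀ v, c * ‖v‖ ^ 2 ≤ ⟪A v, v⟫) (hφ : IsPenalty φ) (ha : 0 ≤ a) (hb : 0 ≤ b) :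
    ∃ F : EuclideanSpace ℝ (Fin p) × EuclideanSpace ℝ (Fin p) → EuclideanSpace ℝ (Fin p),
      Continuous F ∧ ∀ x v, localObjective A φ a b x.1 x.2 (F x) ≤
        localObjective A φ a b x.1 x.2 v := by
  choose F hF using fun x : EuclideanSpace ℝ (Fin p) × EuclideanSpace ℝ (Fin p) =>
    exists_forall_localObjective_le hc hA hφ ha hb x.1 x.2
  refine ⟨F, continuous_iff_continuousAt.2 fun x => ?_, hF⟩
  have hlim : Tendsto (fun y : EuclideanSpace ℝ (Fin p) × EuclideanSpace ℝ (Fin p) =>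
      √(2 / c * (2 / c * ‖y.1 - x.1‖ ^ 2 + 2 * b * p * ‖y.2 - x.2‖))) (𝓝 x) (𝓝 0) := by
    have : Continuous fun y : EuclideanSpace ℝ (Fin p) × EuclideanSpace ℝ (Fin p) =>
      √(2 / c * (2 / c * ‖y.1 - x.1‖ ^ 2 + 2 * b * p * ‖y.2 - x.2‖)) := by fun_prop
    simpa using this.tendsto x
  refine tendsto_iff_norm_sub_tendsto_zero.2
    (squeeze_zero (fun _ => norm_nonneg _) (fun y => Real.le_sqrt_of_sq_le ?_) hlim)
  have := localObjective_minimiser_modulus hc hA hφ ha hb (hF x) (hF y)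
  calc ‖F y - F x‖ ^ 2 = 2 / c * (c / 2 * ‖F y - F x‖ ^ 2) := by field_simp
    _ ≤ _ := by gcongr

/-- A small step along `w` gains to first order `2‖w‖²` from the linear term and costs at most `(a +
b) p ‖w‖` in penalty. This excludes a degenerate limit in regime (ii). -/
lemma norm_le_of_zero_minimiser (ha : 0 ≤ a) (hb : 0 ≤ b) (hφ : IsPenalty φ)
    (h0 : ∀ v, localObjective A φ a b w d 0 ≤ localObjective A φ a b w d v) :
    ‖w‖ ≤ (a + b) * p := by
  by_contra! hlt
  have hw : 0 < ‖w‖ := hlt.trans_le' (by positivity)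
  have hlim : Tendsto (fun t : ℝ => t * ‖A‖) (𝓝[>] 0) (𝓝 (0 * ‖A‖)) :=
    (continuous_id.mul continuous_const).continuousWithinAt
  rw [zero_mul] at hlim
  -- With `t‖A‖ < 1` the quadratic term uses up at most half of the linear gain `2t‖w‖²`.
  obtain ⟨t, ht, ht0⟩ := ((hlim.eventually_lt_const zero_lt_one).and
    (self_mem_nhdsWithin : ∀ᶠ t in 𝓝[>] (0 : ℝ), 0 < t)).exists
  have h1 := h0 (t • w)
  have h2 := (abs_le.1 (hφ.abs_sum_sub_le (t • w) 0)).2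
  have h3 := (abs_le.1 (abs_sum_abs_sub_sub_le (t • w) 0 d)).2
  have h4 : ∑ j, |(t • w - 0) j| ≤ p * (t * ‖w‖) := by
    refine (t • w - 0).sum_abs_le.trans_eq ?_
    rw [sub_zero, norm_smul, Real.norm_of_nonneg ht0.le]
  have h5 := mul_le_mul_of_nonneg_left (h2.trans h4) ha
  have h6 := mul_le_mul_of_nonneg_left (h3.trans h4) hb
  have h7 : ⟪A w, w⟫ ≤ ‖A‖ * ‖w‖ ^ 2 := by
    refine (real_inner_le_norm _ _).trans ?_
    rw [sq, ← mul_assoc]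
    gcongr
    exact A.le_opNorm w
  have h8 : t * (t * ⟪A w, w⟫ - 2 * ‖w‖ ^ 2 + (a + b) * p * ‖w‖) < 0 := by
    refine mul_neg_of_pos_of_neg ht0 ?_
    have := mul_le_mul_of_nonneg_left h7 ht0.le
    nlinarith
  simp only [localObjective, map_zero, inner_zero_right, map_smul,
    inner_smul_left, inner_smul_right, RCLike.conj_to_real, real_inner_self_eq_norm_sq] at h1
  nlinarith

end LocalObjective

/-! ### Weak convergence, tightness and product limits -/

section Probability

variable {Ω Ω' E F : Type*} [MeasurableSpace Ω] [MeasurableSpace Ω'] {P : Measure Ω}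
  [IsProbabilityMeasure P] {P' : Measure Ω'} [IsProbabilityMeasure P']
  [NormedAddCommGroup E] [MeasurableSpace E] [BorelSpace E]

lemma eventually_measure_lt_of_tendstoInDistribution {Y : ℕ → Ω → E} {Z : Ω' → E}
    (h : TendstoInDistribution Y atTop Z (fun _ => P) P') {S : Set E} (hS : IsClosed S)
    {δ : ENNReal} (hδ : P' (Z ⁻¹' S) < δ) : ∀ᶠ n in atTop, P (Y n ⁻¹' S) < δ := by
  have h1 := ProbabilityMeasure.limsup_measure_closed_le_of_tendsto h.tendsto hS
  simp only [ProbabilityMeasure.coe_mk] at h1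
  rw [Measure.map_apply_of_aemeasurable h.aemeasurable_limit hS.measurableSet] at h1
  filter_upwards [eventually_lt_of_limsup_lt (h1.trans_lt hδ)] with n hn
  rwa [Measure.map_apply_of_aemeasurable (h.forall_aemeasurable n) hS.measurableSet] at hn

lemma exists_eventually_measure_norm_lt {Y : ℕ → Ω → E} {Z : Ω' → E}
    (h : TendstoInDistribution Y atTop Z (fun _ => P) P') {δ : ENNReal} (hδ : 0 < δ) :
    ∃ K : ℝ, ∀ᶠ n in atTop, P {ω | K ≤ ‖Y n ω‖} < δ := by
  have hmeas : ∀ k : ℕ, NullMeasurableSet {ω | (k : ℝ) ≤ ‖Z ω‖} P' := fun k =>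
    h.aemeasurable_limit.nullMeasurableSet_preimage
      (isClosed_le continuous_const continuous_norm : IsClosed {x : E | (k : ℝ) ≤ ‖x‖}).measurableSet
  have hlim : Tendsto (fun k : ℕ => P' {ω | (k : ℝ) ≤ ‖Z ω‖}) atTop
      (𝓝 (P' (⋂ k : ℕ, {ω | (k : ℝ) ≤ ‖Z ω‖}))) :=
    tendsto_measure_iInter_atTop hmeas
      (fun i j hij ω (hω : (j : ℝ) ≤ ‖Z ω‖) => (Nat.cast_le.2 hij).trans hω)
      ⟨0, measure_ne_top _ _⟩
  have hempty : (⋂ k : ℕ, {ω | (k : ℝ) ≤ ‖Z ω‖}) = ∅ := by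
    refine Set.eq_empty_of_forall_notMem fun ω hω => ?_
    obtain ⟨k, hk⟩ := exists_nat_gt ‖Z ω‖
    exact absurd (Set.mem_iInter.1 hω k) (not_le.2 hk)
  rw [hempty, measure_empty] at hlim
  obtain ⟨k, hk⟩ := (hlim.eventually_lt_const hδ).exists
  exact ⟨k, eventually_measure_lt_of_tendstoInDistribution h
    (isClosed_le continuous_const continuous_norm) hk⟩

/-- A weakly convergent sequence is tight, so `‖V n‖ ≤ K` outside an event of small probability.
This reduces convergence in probability to a deterministic estimate uniform over bounded inputs. -/
lemma tendstoInMeasure_zero_of_forall_bounded [NormedAddCommGroup F] {V : ℕ → Ω → E} {Z : Ω' → E}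
    (h : TendstoInDistribution V atTop Z (fun _ => P) P') {Y : ℕ → Ω → F}
    (hY : ∀ K : ℝ, ∀ δ : ℝ, 0 < δ → ∀ᶠ n in atTop, ∀ ω, ‖V n ω‖ ≤ K → ‖Y n ω‖ < δ) :
    TendstoInMeasure P Y atTop 0 := by
  rw [tendstoInMeasure_iff_norm]
  intro δ hδ
  refine ENNReal.tendsto_nhds_zero.2 fun τ hτ => ?_
  obtain ⟨K, hK⟩ := exists_eventually_measure_norm_lt h hτ
  filter_upwards [hK, hY K δ hδ] with n h1 h2
  refine (measure_mono fun ω hω => ?_).trans h1.le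
  by_contra hlt
  have := h2 ω (not_le.1 hlt).le
  simp only [Set.mem_ofPred_eq, Pi.zero_apply, sub_zero] at hω
  linarith

lemma tendstoInMeasure_of_tendstoInDistribution_const {Y : ℕ → Ω → E} {c : E}
    (h : TendstoInDistribution Y atTop (fun _ : Ω' => c) (fun _ => P) P') :
    TendstoInMeasure P Y atTop fun _ => c := by
  rw [tendstoInMeasure_iff_norm]
  intro δ hδ
  refine ENNReal.tendsto_nhds_zero.2 fun τ hτ => ?_
  have hS : IsClosed {x : E | δ ≤ ‖x - c‖} := isClosed_le continuous_const (by fun_prop)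
  refine (eventually_measure_lt_of_tendstoInDistribution h hS (δ := τ) ?_).mono fun n hn => hn.le
  have hempty : (fun _ : Ω' => c) ⁻¹' {x : E | δ ≤ ‖x - c‖} = ∅ := by
    ext
    simp [hδ]
  rwa [hempty, measure_empty]

variable [SecondCountableTopology E]

/-- Independence makes each joint law a product of marginals, and the product of probability
measures is weakly continuous. -/
lemma tendstoInDistribution_prodMk_of_indepFun {E' : Type*} [NormedAddCommGroup E']
    [MeasurableSpace E'] [BorelSpace E'] [SecondCountableTopology E'] {Y : ℕ → Ω → E}
    {Y' : ℕ → Ω → E'} {μ : Measure E} [IsProbabilityMeasure μ] {μ' : Measure E'}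
    [IsProbabilityMeasure μ'] (h : TendstoInDistribution Y atTop id (fun _ => P) μ)
    (h' : TendstoInDistribution Y' atTop id (fun _ => P) μ')
    (hind : ∀ n, IndepFun (Y n) (Y' n) P) :
    TendstoInDistribution (fun n ω => (Y n ω, Y' n ω)) atTop id (fun _ => P) (μ.prod μ') where
  forall_aemeasurable n := (h.forall_aemeasurable n).prodMk (h'.forall_aemeasurable n)
  aemeasurable_limit := aemeasurable_id
  tendsto := by
    have := (ProbabilityMeasure.continuous_prod.tendsto (_, _)).comp
      (h.tendsto.prodMk_nhds h'.tendsto)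
    convert! this using 2
    · refine congrArg (fun f => Tendsto f) (funext fun n => Subtype.ext ?_)
      exact (indepFun_iff_map_prod_eq_prod_map_map (h.forall_aemeasurable n)
        (h'.forall_aemeasurable n)).1 (hind n)
    · refine congrArg 𝓝 (Subtype.ext ?_)
      change Measure.map id (μ.prod μ') = (Measure.map id μ).prod (Measure.map id μ')
      simp only [Measure.map_id]

end Probability

/-! ### The Gaussian score -/

section Gaussian

variable {p : ℕ}

/-- The score `n^{-1/2} Xᵀ e`. -/
def normalizedScore {n : ℕ} (X : Matrix (Fin n) (Fin p) ℝ) (e : Fin n → ℝ) :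
    EuclideanSpace ℝ (Fin p) :=
  WithLp.toLp 2 ((1 / √(n : ℝ)) • (Xᵀ *ᵥ e))

/-- The operator of the normalised Gram matrix `n⁻¹ Xᵀ X`. -/
def gramOperator {n : ℕ} (X : Matrix (Fin n) (Fin p) ℝ) :
    EuclideanSpace ℝ (Fin p) →L[ℝ] EuclideanSpace ℝ (Fin p) :=
  Matrix.toEuclideanCLM (n := Fin p) (𝕜 := ℝ) ((1 / (n : ℝ)) • (Xᵀ * X))

lemma continuous_normalizedScore {n : ℕ} (X : Matrix (Fin n) (Fin p) ℝ) :
    Continuous (normalizedScore X) := by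
  unfold normalizedScore
  fun_prop

lemma inner_normalizedScore {n : ℕ} (X : Matrix (Fin n) (Fin p) ℝ) (e : Fin n → ℝ)
    (u : EuclideanSpace ℝ (Fin p)) :
    ⟪normalizedScore X e, u⟫ = 1 / √(n : ℝ) * ∑ i, e i * (X *ᵥ u.ofLp) i := by
  have : ⟪normalizedScore X e, u⟫ = u.ofLp ⬝ᵥ ((1 / √(n : ℝ)) • (Xᵀ *ᵥ e)) := by
    simp [normalizedScore, EuclideanSpace.inner_eq_star_dotProduct]
  rw [this, dotProduct_smul, smul_eq_mul, Matrix.mulVec_transpose, dotProduct_comm,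
    ← Matrix.dotProduct_mulVec]
  rfl

lemma inner_gramOperator {n : ℕ} (X : Matrix (Fin n) (Fin p) ℝ) (u : EuclideanSpace ℝ (Fin p)) :
    ⟪gramOperator X u, u⟫ = 1 / (n : ℝ) * ∑ i, ((X *ᵥ u.ofLp) i) ^ 2 := by
  rw [real_inner_comm, gramOperator, Matrix.inner_toEuclideanCLM, Matrix.smul_mulVec,
    dotProduct_smul, smul_eq_mul, ← Matrix.mulVec_mulVec, Matrix.mulVec_transpose,
    dotProduct_comm, ← Matrix.dotProduct_mulVec]
  simp only [dotProduct, sq]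

/-- Pairing the score with `t` is pairing the noise with `n^{-1/2} X t`, so the characteristic
function factorises over the coordinates. The score is exactly Gaussian for each `n`, with
covariance `σ²` times the Gram matrix. -/
lemma charFun_map_normalizedScore {n : ℕ} (X : Matrix (Fin n) (Fin p) ℝ) (σ : ℝ≥0)
    (t : EuclideanSpace ℝ (Fin p)) :
    charFun ((Measure.pi fun _ : Fin n => gaussianReal 0 (σ ^ 2)).map (normalizedScore X)) t =
      Complex.exp (-((σ ^ 2 * ⟪gramOperator X t, t⟫ / 2 : ℝ) : ℂ)) := by
  set s : EuclideanSpace ℝ (Fin n) := WithLp.toLp 2 ((1 / √(n : ℝ)) • (X *ᵥ t.ofLp)) with hs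
  have h1 : charFun ((Measure.pi fun _ : Fin n => gaussianReal 0 (σ ^ 2)).map
      (normalizedScore X)) t =
      charFun ((Measure.pi fun _ : Fin n => gaussianReal 0 (σ ^ 2)).map (WithLp.toLp 2)) s := by
    rw [charFun_apply, charFun_apply, integral_map, integral_map]
    · refine integral_congr_ae (ae_of_all _ fun e => ?_)
      have : ⟪normalizedScore X e, t⟫ = ⟪WithLp.toLp 2 e, s⟫ := by
        rw [inner_normalizedScore, PiLp.inner_apply, Finset.mul_sum]
        refine Finset.sum_congr rfl fun i _ => ?_
        simp [hs]
        ring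
      simp only [this]
    · fun_prop
    · fun_prop
    · exact (continuous_normalizedScore X).aemeasurable
    · fun_prop
  rw [h1, charFun_pi]
  simp only [charFun_gaussianReal]
  rw [← Complex.exp_sum]
  congr 1
  rw [inner_gramOperator, Finset.mul_sum, Finset.mul_sum, Finset.sum_div, Complex.ofReal_sum,
    ← Finset.sum_neg_distrib]
  refine Finset.sum_congr rfl fun i _ => ?_
  have : s i ^ 2 = 1 / (n : ℝ) * (X *ᵥ t.ofLp) i ^ 2 := by
    simp [hs, mul_pow, Real.sq_sqrt]
  rw [← this]
  push_cast
  ring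

/-- The characteristic functions are explicit in the Gram operator, so its convergence gives theirs,
and Lévy's continuity theorem applies. -/
lemma tendstoInDistribution_normalizedScore {Ω : Type*} [MeasurableSpace Ω] {P : Measure Ω}
    [IsProbabilityMeasure P] {X : (n : ℕ) → Matrix (Fin n) (Fin p) ℝ}
    {C : Matrix (Fin p) (Fin p) ℝ} (hC : C.PosDef)
    (hX : Tendsto (fun n => gramOperator (X n)) atTop (𝓝 (Matrix.toEuclideanCLM (n := Fin p) (𝕜 := ℝ) C)))
    {σ : ℝ≥0} {ε : (n : ℕ) → Ω → Fin n → ℝ}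
    (hε : ∀ n, HasLaw (ε n) (Measure.pi fun _ : Fin n => gaussianReal 0 (σ ^ 2)) P) :
    TendstoInDistribution (fun n ω => normalizedScore (X n) (ε n ω)) atTop id (fun _ => P)
      (multivariateGaussian 0 ((σ : ℝ) ^ 2 • C)) where
  forall_aemeasurable n := (continuous_normalizedScore _).measurable.comp_aemeasurable
    (hε n).aemeasurable
  aemeasurable_limit := aemeasurable_id
  tendsto := by
    refine ProbabilityMeasure.tendsto_iff_tendsto_charFun.2 fun t => ?_
    have hpsd : ((σ : ℝ) ^ 2 • C).PosSemidef := hC.posSemidef.smul (by positivity)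
    have h1 : ∀ n, P.map (fun ω => normalizedScore (X n) (ε n ω)) =
        (Measure.pi fun _ : Fin n => gaussianReal 0 (σ ^ 2)).map (normalizedScore (X n)) := fun n => by
      rw [← (hε n).map_eq, AEMeasurable.map_map_of_aemeasurable
        (continuous_normalizedScore _).aemeasurable (hε n).aemeasurable]
      rfl
    simp only [ProbabilityMeasure.coe_mk, h1, charFun_map_normalizedScore, Measure.map_id,
      charFun_multivariateGaussian hpsd]
    have h2 : (⟪t, (0 : EuclideanSpace ℝ (Fin p))⟫ : ℂ) * Complex.I -
        ((t ⬝ᵥ ((σ : ℝ) ^ 2 • C) *ᵥ t : ℝ) : ℂ) / 2 =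
        -((σ ^ 2 * ⟪Matrix.toEuclideanCLM (n := Fin p) (𝕜 := ℝ) C t, t⟫ / 2 : ℝ) : ℂ) := by
      rw [real_inner_comm t (Matrix.toEuclideanCLM (n := Fin p) (𝕜 := ℝ) C t), inner_zero_right,
        Matrix.inner_toEuclideanCLM, Matrix.smul_mulVec, dotProduct_smul]
      simp
    rw [h2]
    have h3 : Tendsto (fun n => gramOperator (X n) t) atTop
        (𝓝 (Matrix.toEuclideanCLM (n := Fin p) (𝕜 := ℝ) C t)) :=
      ((ContinuousLinearMap.apply ℝ _ t).continuous.tendsto _).comp hX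
    have h4 := ((h3.inner (tendsto_const_nhds (x := t))).const_mul ((σ : ℝ) ^ 2)).div_const 2
    exact (Complex.continuous_exp.tendsto _).comp ((Complex.continuous_ofReal.tendsto _).comp h4).neg

/-- A nondegenerate multivariate Gaussian vector is not almost surely bounded. -/
lemma not_ae_norm_le_multivariateGaussian (hp : 0 < p) {S : Matrix (Fin p) (Fin p) ℝ}
    (hS : S.PosDef) (K : ℝ) : ¬ ∀ᵐ x ∂(multivariateGaussian 0 S), ‖x‖ ≤ K := by
  intro h
  set i : Fin p := ⟨0, hp⟩
  have hmp := measurePreserving_eval_multivariateGaussian (μ := 0) hS.posSemidef (i := i)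
  have hv : (S i i).toNNReal ≠ 0 := by simpa using hS.diag_pos (i := i)
  have h1 : ∀ᵐ x ∂(gaussianReal 0 (S i i).toNNReal), x ∈ Set.Iic K := by
    have e := hmp.map_eq
    simp only [PiLp.zero_apply] at e
    rw [← e]
    refine (ae_map_iff hmp.measurable.aemeasurable (measurableSet_Iic (a := K))).2 ?_
    filter_upwards [h] with x hx using (le_abs_self _).trans ((x.abs_apply_le i).trans hx)
  -- Lebesgue measure is absolutely continuous with respect to a nondegenerate Gaussian, so a
  -- half-line would be conull.
  have h2 : ∀ᵐ x : ℝ, x ∈ Set.Iic K := (gaussianReal_absolutelyContinuous' 0 hv).ae_le h1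
  have h3 : volume (Set.Iic K)ᶜ = 0 := h2
  simp at h3

end Gaussian

/-! ### Coercivity of the limiting Gram operator -/

section Operator

variable {p : ℕ}

lemma Matrix.PosDef.exists_coercive {C : Matrix (Fin p) (Fin p) ℝ} (hC : C.PosDef) :
    ∃ c > 0, ∀ v, c * ‖v‖ ^ 2 ≤ ⟪Matrix.toEuclideanCLM (n := Fin p) (𝕜 := ℝ) C v, v⟫ := by
  set A := Matrix.toEuclideanCLM (n := Fin p) (𝕜 := ℝ) C
  have hpos : ∀ v, v ≠ 0 → 0 < ⟪A v, v⟫ := fun v hv => by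
    rw [real_inner_comm, Matrix.inner_toEuclideanCLM]
    exact hC.dotProduct_mulVec_pos (fun h => hv (by ext j; exact congrFun h j))
  -- An empty unit sphere means that the space is trivial. Otherwise the minimum of the form on the
  -- compact sphere serves as the constant.
  rcases (Metric.sphere (0 : EuclideanSpace ℝ (Fin p)) 1).eq_empty_or_nonempty with he | hne
  · refine ⟨1, one_pos, fun v => ?_⟩
    by_cases hv : v = 0
    · simp [hv]
    · have : ‖v‖⁻¹ • v ∈ Metric.sphere (0 : EuclideanSpace ℝ (Fin p)) 1 := by
        simp [norm_smul, hv]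
      simp [he] at this
  obtain ⟨x, hx, hmin⟩ := (isCompact_sphere (0 : EuclideanSpace ℝ (Fin p)) 1).exists_isMinOn hne
    (f := fun v => ⟪A v, v⟫) (by fun_prop)
  refine ⟨⟪A x, x⟫, hpos x (by rintro rfl; simp at hx), fun v => ?_⟩
  by_cases hv : v = 0
  · simp [hv]
  have hv' : ‖v‖ ≠ 0 := norm_ne_zero_iff.2 hv
  have h1 : ⟪A x, x⟫ ≤ ⟪A (‖v‖⁻¹ • v), ‖v‖⁻¹ • v⟫ :=
    hmin (show ‖v‖⁻¹ • v ∈ Metric.sphere (0 : EuclideanSpace ℝ (Fin p)) 1 by simp [norm_smul, hv])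
  simp only [map_smul, inner_smul_left, inner_smul_right, RCLike.conj_to_real] at h1
  calc ⟪A x, x⟫ * ‖v‖ ^ 2 ≤ ‖v‖⁻¹ * (‖v‖⁻¹ * ⟪A v, v⟫) * ‖v‖ ^ 2 := by gcongr
    _ = ⟪A v, v⟫ := by field_simp

lemma coercive_of_norm_sub_le {E : Type*} [NormedAddCommGroup E] [InnerProductSpace ℝ E]
    {A B : E →L[ℝ] E} {c δ : ℝ} (hA : ∀ v, c * ‖v‖ ^ 2 ≤ ⟪A v, v⟫) (hAB : ‖A - B‖ ≤ δ) (v : E) :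
    (c - δ) * ‖v‖ ^ 2 ≤ ⟪B v, v⟫ := by
  have h1 : ⟪(A - B) v, v⟫ ≤ δ * ‖v‖ ^ 2 :=
    calc ⟪(A - B) v, v⟫ ≤ ‖(A - B) v‖ * ‖v‖ := real_inner_le_norm _ _
      _ ≤ δ * ‖v‖ * ‖v‖ := by
        gcongr
        exact (A - B).le_of_opNorm_le hAB v
      _ = _ := by ring
  simp only [sub_apply, inner_sub_left] at h1
  linarith [hA v]

lemma tendsto_gramOperator {X : (n : ℕ) → Matrix (Fin n) (Fin p) ℝ}
    {C : Matrix (Fin p) (Fin p) ℝ}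
    (hX : Tendsto (fun n : ℕ => (1 / (n : ℝ)) • ((X n)ᵀ * X n)) atTop (𝓝 C)) :
    Tendsto (fun n => gramOperator (X n)) atTop
      (𝓝 (Matrix.toEuclideanCLM (n := Fin p) (𝕜 := ℝ) C)) :=
  ((LinearMap.continuous_of_finiteDimensional
    (IsLinearMap.mk' (Matrix.toEuclideanCLM (n := Fin p) (𝕜 := ℝ))
      ⟨map_add _, map_smul _⟩)).tendsto C).comp hX

end Operator

/-! ### The lasso penalty near the true parameter -/

section Penalties

variable {p : ℕ}

/-- The increment of the rescaled lasso penalty at the true parameter `β`. -/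
def lassoIncrement (β : EuclideanSpace ℝ (Fin p)) (s : ℝ) (j : Fin p) (x : ℝ) : ℝ :=
  |s * β j + x| - |s * β j|

/-- The limit of `lassoIncrement β s` as `s → ∞`. -/
def lassoSlope (β : EuclideanSpace ℝ (Fin p)) (j : Fin p) (x : ℝ) : ℝ :=
  if 0 < β j then x else if β j < 0 then -x else |x|

lemma isPenalty_lassoIncrement (β : EuclideanSpace ℝ (Fin p)) (s : ℝ) :
    IsPenalty (lassoIncrement β s) where
  convex j := by
    refine ⟨convex_univ, fun x _ y _ t r ht hr htr => ?_⟩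
    simp only [lassoIncrement, smul_eq_mul]
    have h1 : s * β j + (t * x + r * y) = t * (s * β j + x) + r * (s * β j + y) := by
      linear_combination -(s * β j) * htr
    have h2 := abs_add_le (t * (s * β j + x)) (r * (s * β j + y))
    rw [abs_mul, abs_mul, abs_of_nonneg ht, abs_of_nonneg hr] at h2
    rw [h1]
    have h3 : |s * β j| = t * |s * β j| + r * |s * β j| := by rw [← add_mul, htr, one_mul]
    linarith
  abs_sub_le j x y := by
    simpa [lassoIncrement] using abs_abs_sub_abs_le (s * β j + x) (s * β j + y)
  map_zero j := by simp [lassoIncrement]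

lemma isPenalty_lassoSlope (β : EuclideanSpace ℝ (Fin p)) : IsPenalty (lassoSlope β) where
  convex j := by
    unfold lassoSlope
    split_ifs
    · exact convexOn_id convex_univ
    · exact (concaveOn_id convex_univ).neg
    · exact convexOn_univ_norm
  abs_sub_le j x y := by
    unfold lassoSlope
    split_ifs
    · exact le_rfl
    · rw [neg_sub_neg, abs_sub_comm]
    · exact abs_abs_sub_abs_le x y
  map_zero j := by simp [lassoSlope]

/-- While `|x| ≤ s|β j|`, the shift by `x` does not cross zero, so the absolute value is linear
there. At `β j = 0` both sides are `|x|`. -/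
lemma lassoIncrement_eq_lassoSlope {β : EuclideanSpace ℝ (Fin p)} {s x : ℝ} {j : Fin p}
    (h : β j ≠ 0 → |x| ≤ s * |β j|) : lassoIncrement β s j x = lassoSlope β j x := by
  unfold lassoIncrement lassoSlope
  rcases lt_trichotomy (β j) 0 with hj | hj | hj
  · have h1 := abs_le.1 (h hj.ne)
    rw [abs_of_neg hj] at h1
    rw [if_neg hj.not_gt, if_pos hj, abs_of_nonpos (by linarith), abs_of_nonpos (by linarith)]
    ring
  · simp [hj]
  · have h1 := abs_le.1 (h hj.ne')
    rw [abs_of_pos hj] at h1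
    rw [if_pos hj, abs_of_nonneg (by linarith), abs_of_nonneg (by linarith)]
    ring

/-- On bounded sets the limit is attained exactly for large `n`, which is the form required by
`localObjective_stability`. -/
lemma eventually_lassoIncrement_eq (β : EuclideanSpace ℝ (Fin p)) {s : ℕ → ℝ}
    (hs : Tendsto s atTop atTop) (R : ℝ) :
    ∀ᶠ n in atTop, ∀ j x, |x| ≤ R → lassoIncrement β (s n) j x = lassoSlope β j x := by
  refine eventually_all.2 fun j => ?_
  by_cases hj : β j = 0
  · exact Eventually.of_forall fun n x _ => lassoIncrement_eq_lassoSlope fun h => absurd hj h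
  · filter_upwards [(hs.atTop_mul_const (abs_pos.2 hj)).eventually_ge_atTop R] with n hn x hx
    exact lassoIncrement_eq_lassoSlope fun _ => hx.trans hn

lemma lassoSlope_neg_smul (β : EuclideanSpace ℝ (Fin p)) (t : ℝ) (j : Fin p) :
    lassoSlope β j ((-t • β) j) = -(t * |β j|) := by
  simp only [lassoSlope, PiLp.smul_apply, smul_eq_mul]
  rcases lt_trichotomy (β j) 0 with hj | hj | hj
  · rw [if_neg hj.not_gt, if_pos hj, abs_of_neg hj]
    ring
  · simp [hj]
  · rw [if_pos hj, abs_of_pos hj]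
    ring

end Penalties

/-! ### Rescaling the objective and comparing minimisers -/

section Deterministic

variable {p : ℕ}

/-- The terms free of `v` are split off and the factor `s⁻²` is positive, so minimisers correspond
under the rescaling. Leaving `s` free serves all three regimes. -/
lemma transferLassoObjective_add_smul {n : ℕ} (hn : 0 < n) (X : Matrix (Fin n) (Fin p) ℝ)
    (e : Fin n → ℝ) (lam eta : ℝ) (β β₀ v : EuclideanSpace ℝ (Fin p)) {s : ℝ} (hs : 0 < s) :
    transferLassoObjective X (X *ᵥ β.ofLp + e) lam eta β₀ (β + s⁻¹ • v) =
      1 / n * ∑ i, e i ^ 2 + lam / n * ∑ j, |β j| +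
      (s⁻¹) ^ 2 * localObjective (gramOperator X) (lassoIncrement β s) (lam * s / n)
        (eta * s / n) ((s / √(n : ℝ)) • normalizedScore X e) (s • (β₀ - β)) v := by
  have hn' : (0 : ℝ) < n := by exact_mod_cast hn
  have h1 : ∑ i, ((X *ᵥ β.ofLp + e) i - (X *ᵥ (β + s⁻¹ • v).ofLp) i) ^ 2 =
      ∑ i, e i ^ 2 - 2 * s⁻¹ * ∑ i, e i * (X *ᵥ v.ofLp) i +
        (s⁻¹) ^ 2 * ∑ i, (X *ᵥ v.ofLp) i ^ 2 := by
    rw [Finset.mul_sum, Finset.mul_sum, ← Finset.sum_sub_distrib, ← Finset.sum_add_distrib]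
    refine Finset.sum_congr rfl fun i _ => ?_
    simp only [WithLp.ofLp_add, WithLp.ofLp_smul, Matrix.mulVec_add, Matrix.mulVec_smul,
      Pi.add_apply, Pi.smul_apply, smul_eq_mul]
    ring
  have habs : ∀ x : ℝ, |s⁻¹ * x| = s⁻¹ * |x| := fun x => by
    rw [abs_mul, abs_of_pos (inv_pos.2 hs)]
  have h2 : ∑ j, |(β + s⁻¹ • v) j| = ∑ j, |β j| + s⁻¹ * ∑ j, lassoIncrement β s j (v j) := by
    rw [Finset.mul_sum, ← Finset.sum_add_distrib]
    refine Finset.sum_congr rfl fun j _ => ?_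
    rw [lassoIncrement, mul_sub, ← habs, ← habs, mul_add, inv_mul_cancel_left₀ hs.ne']
    simp
  have h3 : ∑ j, |(β + s⁻¹ • v) j - β₀ j| = s⁻¹ * ∑ j, |v j - (s • (β₀ - β)) j| := by
    rw [Finset.mul_sum]
    refine Finset.sum_congr rfl fun j _ => ?_
    rw [← habs, mul_sub]
    simp only [PiLp.add_apply, PiLp.smul_apply, PiLp.sub_apply, smul_eq_mul]
    rw [inv_mul_cancel_left₀ hs.ne']
    congr 1
    ring
  have hsq : √(n : ℝ) * √(n : ℝ) = n := Real.mul_self_sqrt hn'.le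
  have h4 : s / √(n : ℝ) * (1 / √(n : ℝ)) = s / n := by rw [div_mul_div_comm, mul_one, hsq]
  rw [transferLassoObjective, h1, h2, h3, localObjective, inner_gramOperator, inner_smul_left,
    inner_normalizedScore, RCLike.conj_to_real, ← mul_assoc (s / √(n : ℝ)), h4]
  field_simp
  ring

lemma IsTransferLasso.localObjective_le {n : ℕ} (hn : 0 < n) {X : Matrix (Fin n) (Fin p) ℝ}
    {e : Fin n → ℝ} {lam eta : ℝ} {β β₀ βhat : EuclideanSpace ℝ (Fin p)}
    (h : IsTransferLasso X (X *ᵥ β.ofLp + e) lam eta β₀ βhat) {s : ℝ} (hs : 0 < s)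
    (v : EuclideanSpace ℝ (Fin p)) :
    localObjective (gramOperator X) (lassoIncrement β s) (lam * s / n) (eta * s / n)
        ((s / √(n : ℝ)) • normalizedScore X e) (s • (β₀ - β)) (s • (βhat - β)) ≤
      localObjective (gramOperator X) (lassoIncrement β s) (lam * s / n) (eta * s / n)
        ((s / √(n : ℝ)) • normalizedScore X e) (s • (β₀ - β)) v := by
  have h1 : transferLassoObjective X (X *ᵥ β.ofLp + e) lam eta β₀ βhat ≤
      transferLassoObjective X (X *ᵥ β.ofLp + e) lam eta β₀ (β + s⁻¹ • v) :=
    h (Set.mem_univ _)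
  have h2 : βhat = β + s⁻¹ • (s • (βhat - β)) := by
    rw [smul_smul, inv_mul_cancel₀ hs.ne', one_smul, add_sub_cancel]
  rw [transferLassoObjective_add_smul hn X e lam eta β β₀ v hs] at h1
  nth_rewrite 1 [h2] at h1
  rw [transferLassoObjective_add_smul hn X e lam eta β β₀ _ hs] at h1
  exact le_of_mul_le_mul_left (by linarith) (by positivity : 0 < (s⁻¹) ^ 2)

/-- If the centred penalty dominates, the minimiser is the centre itself. -/
lemma eq_center_of_localObjective_le
    {A : EuclideanSpace ℝ (Fin p) →L[ℝ] EuclideanSpace ℝ (Fin p)} {φ : Fin p → ℝ → ℝ}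
    {a b : ℝ} {w d u : EuclideanSpace ℝ (Fin p)} (hA : ∀ v, 0 ≤ ⟪A v, v⟫) (hφ : IsPenalty φ)
    (ha : 0 ≤ a) (hlt : 2 * ‖w‖ + 2 * ‖A‖ * ‖d‖ < b - a)
    (hu : localObjective A φ a b w d u ≤ localObjective A φ a b w d d) : u = d := by
  by_contra hne
  have hpos : 0 < ‖u - d‖ := norm_pos_iff.2 (sub_ne_zero.2 hne)
  -- Moving from `d` to `u` costs `b` and saves at most `a` times the `ℓ¹` distance. Expanding the
  -- quadratic part at `d` and dropping `⟪A (u - d), u - d⟫ ≥ 0` saves at most `(2‖w‖ + 2‖A‖‖d‖)‖u -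
  -- d‖`.
  have h1 := mul_le_mul_of_nonneg_left (abs_le.1 (hφ.abs_sum_sub_le u d)).1 ha
  have h2 := (u - d).norm_le_sum_abs
  have h3 := hA (u - d)
  have h4 : ⟪w, u - d⟫ ≤ ‖w‖ * ‖u - d‖ := real_inner_le_norm _ _
  have h5 : -⟪A d, u - d⟫ ≤ ‖A‖ * ‖d‖ * ‖u - d‖ := by
    refine (neg_le_abs _).trans ((abs_real_inner_le_norm _ _).trans ?_)
    gcongr
    exact A.le_opNorm d
  have h6 : -⟪A (u - d), d⟫ ≤ ‖A‖ * ‖u - d‖ * ‖d‖ := by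
    refine (neg_le_abs _).trans ((abs_real_inner_le_norm _ _).trans ?_)
    gcongr
    exact A.le_opNorm (u - d)
  have h7 : ∑ j, |(u - d) j| = ∑ j, |u j - d j| := rfl
  have h8 : (b - a) * ‖u - d‖ ≤ (b - a) * ∑ j, |(u - d) j| :=
    mul_le_mul_of_nonneg_left h2 (hlt.le.trans' (by positivity))
  have h9 := mul_lt_mul_of_pos_right hlt hpos
  simp only [localObjective, sub_self, abs_zero, Finset.sum_const_zero, mul_zero, add_zero] at hu
  simp only [map_sub, inner_sub_left, inner_sub_right] at h3 h4 h5 h6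
  rw [h7] at h1 h8
  nlinarith

/-- Only `w` has to be bounded: neither the a priori radius nor the stability estimate involves `d`.
-/
lemma eventually_norm_sub_lt_of_minimisers
    {A : EuclideanSpace ℝ (Fin p) →L[ℝ] EuclideanSpace ℝ (Fin p)}
    {An : ℕ → EuclideanSpace ℝ (Fin p) →L[ℝ] EuclideanSpace ℝ (Fin p)}
    (hAn : Tendsto An atTop (𝓝 A)) {c : ℝ} (hc : 0 < c) (hA : ∀ v, c * ‖v‖ ^ 2 ≤ ⟪A v, v⟫)
    {φ : Fin p → ℝ → ℝ} {φn : ℕ → Fin p → ℝ → ℝ} (hφ : IsPenalty φ) (hφn : ∀ n, IsPenalty (φn n))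
    (hφφ : ∀ R : ℝ, ∀ᶠ n in atTop, ∀ j x, |x| ≤ R → φn n j x = φ j x)
    {a b : ℝ} {an bn : ℕ → ℝ} (ha : 0 ≤ a) (hb : 0 ≤ b) (han : Tendsto an atTop (𝓝 a))
    (hbn : Tendsto bn atTop (𝓝 b)) (han0 : ∀ᶠ n in atTop, 0 ≤ an n)
    (hbn0 : ∀ᶠ n in atTop, 0 ≤ bn n) (K : ℝ) {δ : ℝ} (hδ : 0 < δ) :
    ∀ᶠ n in atTop, ∀ w d u u' : EuclideanSpace ℝ (Fin p), ‖w‖ ≤ K →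
      (∀ v, localObjective A φ a b w d u ≤ localObjective A φ a b w d v) →
      (∀ v, localObjective (An n) (φn n) (an n) (bn n) w d u' ≤
        localObjective (An n) (φn n) (an n) (bn n) w d v) → ‖u' - u‖ < δ := by
  -- A radius valid for both minimisers: eventually the weights are at most `a + 1` and `b + 1`, and
  -- `An n` is coercive with constant `c / 2`.
  set R := (2 * K + (a + 1 + (b + 1)) * p) / (c / 2) with hR
  have hAn0 : Tendsto (fun n => ‖A - An n‖) atTop (𝓝 0) := by
    simpa using (tendsto_const_nhds (x := A)).sub hAn |>.norm
  have han' : Tendsto (fun n => |a - an n|) atTop (𝓝 0) := by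
    simpa using (tendsto_const_nhds (x := a)).sub han |>.abs
  have hbn' : Tendsto (fun n => |b - bn n|) atTop (𝓝 0) := by
    simpa using (tendsto_const_nhds (x := b)).sub hbn |>.abs
  have herr : Tendsto (fun n => 2 * ‖A - An n‖ * R ^ 2 +
      (|a - an n| + |b - bn n|) * (p * (2 * R))) atTop (𝓝 0) := by
    simpa using ((hAn0.const_mul 2).mul_const (R ^ 2)).add
      ((han'.add hbn').mul_const (p * (2 * R)))
  filter_upwards [hAn0.eventually_le_const (half_pos hc), han0, hbn0,
    han.eventually_le_const (lt_add_one a), hbn.eventually_le_const (lt_add_one b), hφφ R,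
    herr.eventually_lt_const (by positivity : 0 < c * δ ^ 2)] with n h1 h2 h3 h4 h5 h6 h7
  intro w d u u' hw hu hu'
  have hK : 0 ≤ K := (norm_nonneg w).trans hw
  have hAn' : ∀ v, c / 2 * ‖v‖ ^ 2 ≤ ⟪An n v, v⟫ := fun v => by
    simpa [sub_half] using coercive_of_norm_sub_le hA h1 v
  have huR : ‖u‖ ≤ R := by
    refine (norm_le_of_forall_localObjective_le hc hA hφ ha hb hu).trans ?_
    rw [hR]
    gcongr <;> linarith
  have huR' : ‖u'‖ ≤ R := by
    refine (norm_le_of_forall_localObjective_le (half_pos hc) hAn' (hφn n) h2 h3 hu').trans ?_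
    rw [hR]
    gcongr
  have h8 := (localObjective_stability hA hφ ha hb hu hu' huR huR' h6).trans_lt h7
  exact lt_of_pow_lt_pow_left₀ 2 hδ.le (lt_of_mul_lt_mul_left h8 hc.le)

/-- The penalty `φ` can fall by at most the `ℓ¹` norm of `u`, which the centred penalty with `b ≥ 1`
repays; the coercive quadratic then forces `u = 0`. -/
lemma localObjective_minimiser_eq_zero
    {A : EuclideanSpace ℝ (Fin p) →L[ℝ] EuclideanSpace ℝ (Fin p)} {φ : Fin p → ℝ → ℝ} {b c : ℝ}
    {u : EuclideanSpace ℝ (Fin p)} (hc : 0 < c) (hA : ∀ v, c * ‖v‖ ^ 2 ≤ ⟪A v, v⟫)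
    (hφ : IsPenalty φ) (hb : 1 ≤ b)
    (hu : localObjective A φ 1 b 0 0 u ≤ localObjective A φ 1 b 0 0 0) : u = 0 := by
  have h1 := (abs_le.1 (hφ.abs_sum_sub_le u 0)).1
  have h2 : 0 ≤ ∑ j, |u j| := Finset.sum_nonneg fun j _ => abs_nonneg _
  have h3 := hA u
  have h4 : ‖u‖ ^ 2 ≤ 0 := by
    rw [sub_zero] at h1
    simp only [localObjective, map_zero, inner_zero_right, inner_zero_left, PiLp.zero_apply,
      sub_zero, abs_zero, Finset.sum_const_zero] at hu h1
    by_contra! hlt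
    nlinarith [mul_pos hc hlt, mul_le_mul_of_nonneg_right hb h2]
  exact norm_eq_zero.1 (pow_eq_zero_iff two_ne_zero |>.1 (h4.antisymm (sq_nonneg _)))

/-- Shrinking along `-β` changes the two penalties together by `-(1 - b) t ∑ |β j|`, which beats the
quadratic cost of order `t²` for small `t`. -/
lemma localObjective_minimiser_ne_zero
    {A : EuclideanSpace ℝ (Fin p) →L[ℝ] EuclideanSpace ℝ (Fin p)}
    {β u : EuclideanSpace ℝ (Fin p)} {b : ℝ} (hβ : β ≠ 0) (hb : b < 1)
    (hu : ∀ v, localObjective A (lassoSlope β) 1 b 0 0 u ≤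
      localObjective A (lassoSlope β) 1 b 0 0 v) : u ≠ 0 := by
  rintro rfl
  set S := ∑ j, |β j|
  have hS : 0 < S := (norm_pos_iff.2 hβ).trans_le β.norm_le_sum_abs
  have hlim : Tendsto (fun t : ℝ => t * ⟪A β, β⟫) (𝓝[>] 0) (𝓝 (0 * ⟪A β, β⟫)) :=
    (continuous_id.mul continuous_const).continuousWithinAt
  rw [zero_mul] at hlim
  obtain ⟨t, ht, ht0⟩ := ((hlim.eventually_lt_const
    (mul_pos (sub_pos.2 hb) hS)).and (self_mem_nhdsWithin : ∀ᶠ t in 𝓝[>] (0 : ℝ), 0 < t)).exists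
  have h1 := hu (-t • β)
  have h2 : ∑ j, |(-t • β) j| = t * S := by
    rw [Finset.mul_sum]
    refine Finset.sum_congr rfl fun j _ => ?_
    simp [abs_mul, abs_of_pos ht0]
  have h3 : ∑ j, lassoSlope β j ((-t • β) j) = -(t * S) := by
    simp only [lassoSlope_neg_smul β t, Finset.sum_neg_distrib, ← Finset.mul_sum, S]
  have h4 : ∑ j, lassoSlope β j 0 = 0 :=
    Finset.sum_eq_zero fun j _ => (isPenalty_lassoSlope β).map_zero j
  simp only [localObjective, h3, h4, PiLp.zero_apply, sub_zero, h2, map_zero, inner_zero_right,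
    inner_zero_left, abs_zero, Finset.sum_const_zero, map_smul, inner_smul_left,
    inner_smul_right, RCLike.conj_to_real] at h1
  nlinarith [mul_lt_mul_of_pos_left ht ht0]

end Deterministic

/-! ### Limit laws and rates -/

section Asymptotics

variable {Ω : Type*} [MeasurableSpace Ω] {P : Measure Ω} [IsProbabilityMeasure P] {p : ℕ}

lemma tendstoInMeasure_const_of_tendsto {F : Type*} [NormedAddCommGroup F] {x : ℕ → F} {y : F}
    (h : Tendsto x atTop (𝓝 y)) :
    TendstoInMeasure P (fun n (_ : Ω) => x n) atTop fun _ => y :=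
  tendstoInMeasure_of_tendsto_ae (fun _ => aestronglyMeasurable_const) (ae_of_all _ fun _ => h)

/-- Limit law of a rescaled Transfer Lasso error, for a general scaling sequence `s`. -/
theorem tendstoInDistribution_smul_transferLasso
    {X : (n : ℕ) → Matrix (Fin n) (Fin p) ℝ} {ε : (n : ℕ) → Ω → Fin n → ℝ}
    {β : EuclideanSpace ℝ (Fin p)} {m : ℕ → ℕ} (hm : ∀ᶠ n in atTop, 0 < m n)
    {βinit βhat : ℕ → Ω → EuclideanSpace ℝ (Fin p)} {lam eta : ℕ → ℝ}
    (hlam : ∀ n, 0 ≤ lam n) (heta : ∀ n, 0 ≤ eta n) (hβhat : ∀ n, AEMeasurable (βhat n) P)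
    (hmin : ∀ n ω, IsTransferLasso (X n) (X n *ᵥ β.ofLp + ε n ω) (lam n) (eta n)
      (βinit n ω) (βhat n ω))
    {Q : Measure (EuclideanSpace ℝ (Fin p) × EuclideanSpace ℝ (Fin p))} [IsProbabilityMeasure Q]
    (hV : TendstoInDistribution (fun n ω => (normalizedScore (X n) (ε n ω),
      √(m n : ℝ) • (βinit n ω - β))) atTop id (fun _ => P) Q)
    {A : EuclideanSpace ℝ (Fin p) →L[ℝ] EuclideanSpace ℝ (Fin p)}
    (hAn : Tendsto (fun n => gramOperator (X n)) atTop (𝓝 A)) {c : ℝ} (hc : 0 < c)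
    (hA : ∀ v, c * ‖v‖ ^ 2 ≤ ⟪A v, v⟫) {s : ℕ → ℝ} (hs : Tendsto s atTop atTop) {κ κ' a b : ℝ}
    (hκ : Tendsto (fun n : ℕ => s n / √(n : ℝ)) atTop (𝓝 κ))
    (hκ' : Tendsto (fun n : ℕ => s n / √(m n : ℝ)) atTop (𝓝 κ'))
    (ha : Tendsto (fun n : ℕ => lam n * s n / n) atTop (𝓝 a))
    (hb : Tendsto (fun n : ℕ => eta n * s n / n) atTop (𝓝 b)) (ha0 : 0 ≤ a) (hb0 : 0 ≤ b)
    {F : EuclideanSpace ℝ (Fin p) × EuclideanSpace ℝ (Fin p) → EuclideanSpace ℝ (Fin p)}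
    (hF : Continuous F) (hFmin : ∀ x v, localObjective A (lassoSlope β) a b x.1 x.2 (F x) ≤
      localObjective A (lassoSlope β) a b x.1 x.2 v) :
    TendstoInDistribution (fun n ω => s n • (βhat n ω - β)) atTop
      (fun x => F (κ • x.1, κ' • x.2)) (fun _ => P) Q := by
  have hg : Continuous fun y : (EuclideanSpace ℝ (Fin p) × EuclideanSpace ℝ (Fin p)) × (ℝ × ℝ) =>
      F (y.2.1 • y.1.1, y.2.2 • y.1.2) := by fun_prop
  -- Slutsky and continuous mapping, for the limit minimiser evaluated at the finite-`n` inputs.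
  -- What remains is its distance to the actual estimator.
  have hlim := hV.continuous_comp_prodMk_of_tendstoInMeasure_const hg
    (tendstoInMeasure_const_of_tendsto (P := P) (hκ.prodMk_nhds hκ')) fun _ => aemeasurable_const
  refine tendstoInDistribution_of_tendstoInMeasure_sub _ _ hlim ?_
    fun n => ((hβhat n).sub_const β).const_smul (s n)
  refine tendstoInMeasure_zero_of_forall_bounded hV fun K δ hδ => ?_
  have hs0 := hs.eventually_gt_atTop 0
  filter_upwards [eventually_norm_sub_lt_of_minimisers hAn hc hA (isPenalty_lassoSlope β)
    (fun n => isPenalty_lassoIncrement β (s n)) (eventually_lassoIncrement_eq β hs) ha0 hb0 ha hb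
    (hs0.mono fun n hn => div_nonneg (mul_nonneg (hlam n) hn.le) n.cast_nonneg)
    (hs0.mono fun n hn => div_nonneg (mul_nonneg (heta n) hn.le) n.cast_nonneg)
    ((|κ| + 1) * K) hδ, hs0, eventually_gt_atTop 0, hm,
    hκ.abs.eventually_le_const (lt_add_one |κ|)] with n h1 h2 h3 h4 h5 ω hω
  have hm' : √(m n : ℝ) ≠ 0 := (Real.sqrt_pos.2 (Nat.cast_pos.2 h4)).ne'
  have hd : (s n / √(m n : ℝ)) • √(m n : ℝ) • (βinit n ω - β) = s n • (βinit n ω - β) := by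
    rw [smul_smul, div_mul_cancel₀ _ hm']
  refine h1 ((s n / √(n : ℝ)) • normalizedScore (X n) (ε n ω))
    ((s n / √(m n : ℝ)) • √(m n : ℝ) • (βinit n ω - β)) _ _ ?_
    (hFmin ((s n / √(n : ℝ)) • normalizedScore (X n) (ε n ω),
      (s n / √(m n : ℝ)) • √(m n : ℝ) • (βinit n ω - β))) ?_
  · rw [norm_smul]
    exact mul_le_mul h5 ((norm_fst_le _).trans hω) (norm_nonneg _) (by positivity)
  · rw [hd]
    exact (hmin n ω).localObjective_le h3 h2

lemma tendstoInDistribution_id_map {Ω' E : Type*} [MeasurableSpace Ω'] {P' : Measure Ω'}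
    [IsProbabilityMeasure P'] [TopologicalSpace E] [MeasurableSpace E] [OpensMeasurableSpace E]
    {Y : ℕ → Ω → E} {Z : Ω' → E} (h : TendstoInDistribution Y atTop Z (fun _ => P) P')
    [IsProbabilityMeasure (P'.map Z)] :
    TendstoInDistribution Y atTop id (fun _ => P) (P'.map Z) where
  forall_aemeasurable := h.forall_aemeasurable
  aemeasurable_limit := aemeasurable_id
  tendsto := by
    convert! h.tendsto using 2
    exact congrArg 𝓝 (Subtype.ext Measure.map_id)

section Rates

variable {Ω' E : Type*} [MeasurableSpace Ω'] {P' : Measure Ω'} [IsProbabilityMeasure P']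
  [NormedAddCommGroup E] [NormedSpace ℝ E] [MeasurableSpace E] [BorelSpace E]
  {err : ℕ → Ω → E} {a : ℕ → ℝ} {Z : Ω' → E}

lemma convergesAtRate_of_tendstoInDistribution
    (h : TendstoInDistribution (fun n ω => a n • err n ω) atTop Z (fun _ => P) P') :
    ConvergesAtRate P err a :=
  have := Measure.isProbabilityMeasure_map h.aemeasurable_limit
  ⟨⟨P'.map Z, this⟩, tendstoInDistribution_id_map h⟩

lemma hasConvergenceRate_of_tendstoInDistribution
    (h : TendstoInDistribution (fun n ω => a n • err n ω) atTop Z (fun _ => P) P')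
    (hne : ¬ ∀ᵐ ω ∂P', Z ω = 0) : HasConvergenceRate P err a := by
  have := Measure.isProbabilityMeasure_map h.aemeasurable_limit
  refine ⟨⟨P'.map Z, this⟩, tendstoInDistribution_id_map h, fun heq => hne ?_⟩
  have h1 : ∀ᵐ x ∂(P'.map Z), x ∈ ({0} : Set E) := by
    rw [show P'.map Z = Measure.dirac 0 from heq]
    exact (ae_dirac_iff (p := (· ∈ ({0} : Set E))) (measurableSet_singleton 0)).2 rfl
  exact ae_of_ae_map h.aemeasurable_limit h1

end Rates

lemma not_isBoundedInProbability_of_tendstoInMeasure {E : Type*} [NormedAddCommGroup E]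
    [NormedSpace ℝ E] {Y : ℕ → Ω → E} {y : E} (hy : y ≠ 0)
    (h : TendstoInMeasure P Y atTop fun _ => y) {r : ℕ → ℝ} (hr : Tendsto r atTop atTop)
    {T : ℕ → Ω → E} (hT : ∀ᶠ n in atTop, ∀ ω, T n ω = r n • Y n ω) :
    ¬ IsBoundedInProbability P T := by
  intro hbdd
  obtain ⟨K, hK⟩ := hbdd (1 / 2) (by norm_num)
  have hy' : 0 < ‖y‖ / 2 := half_pos (norm_pos_iff.2 hy)
  have h1 := (tendstoInMeasure_iff_measureReal_norm.1 h (‖y‖ / 2) hy').eventually_lt_const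
    (by norm_num : (0 : ℝ) < 1 / 2)
  obtain ⟨n, h2, h3, h4, h5, h6⟩ := (hK.and (h1.and (hT.and
    ((hr.eventually_gt_atTop 0).and
      ((hr.atTop_mul_const hy').eventually_gt_atTop K))))).exists
  -- Where `Y n` is within `‖y‖ / 2` of `y`, the norm of `T n` is at least `r n * ‖y‖ / 2 > K`. The
  -- two covering events have total probability below one.
  have hcover : (Set.univ : Set Ω) ⊆ {ω | K < ‖T n ω‖} ∪ {ω | ‖y‖ / 2 ≤ ‖Y n ω - y‖} := by
    intro ω _
    by_cases hω : ‖y‖ / 2 ≤ ‖Y n ω - y‖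
    · exact Or.inr hω
    · left
      have h7 := norm_sub_norm_le y (Y n ω)
      rw [norm_sub_rev] at h7
      change K < ‖T n ω‖
      rw [h4 ω, norm_smul, Real.norm_of_nonneg h5.le]
      exact h6.trans_le (mul_le_mul_of_nonneg_left (by linarith) h5.le)
  have h8 := (measureReal_mono (μ := P) hcover).trans (measureReal_union_le _ _)
  rw [probReal_univ] at h8
  linarith

end Asymptotics

/-! ### Dominant transfer penalty -/

section Domination

variable {Ω : Type*} [MeasurableSpace Ω] {P : Measure Ω} [IsProbabilityMeasure P] {p : ℕ}

/-- If the transfer penalty dominates, the Transfer Lasso agrees with the initial estimator with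
probability tending to one. -/
lemma tendstoInMeasure_transferLasso_sub_init
    {X : (n : ℕ) → Matrix (Fin n) (Fin p) ℝ} {ε : (n : ℕ) → Ω → Fin n → ℝ}
    {β : EuclideanSpace ℝ (Fin p)} {m : ℕ → ℕ} (hm : ∀ᶠ n in atTop, 0 < m n)
    {r₀ : ℝ} (hr₀ : Tendsto (fun n : ℕ => (n : ℝ) / (m n : ℝ)) atTop (𝓝 r₀))
    {βinit βhat : ℕ → Ω → EuclideanSpace ℝ (Fin p)} {lam eta : ℕ → ℝ}
    (hlam : ∀ n, 0 ≤ lam n)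
    (hmin : ∀ n ω, IsTransferLasso (X n) (X n *ᵥ β.ofLp + ε n ω) (lam n) (eta n)
      (βinit n ω) (βhat n ω))
    {Q : Measure (EuclideanSpace ℝ (Fin p) × EuclideanSpace ℝ (Fin p))} [IsProbabilityMeasure Q]
    (hV : TendstoInDistribution (fun n ω => (normalizedScore (X n) (ε n ω),
      √(m n : ℝ) • (βinit n ω - β))) atTop id (fun _ => P) Q)
    {A : EuclideanSpace ℝ (Fin p) →L[ℝ] EuclideanSpace ℝ (Fin p)}
    (hAn : Tendsto (fun n => gramOperator (X n)) atTop (𝓝 A)) {ρ₀ : ℝ} (hρ₀ : ρ₀ < 1)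
    (h1 : Tendsto (fun n : ℕ => eta n / √(n : ℝ)) atTop atTop)
    (h2 : Tendsto (fun n : ℕ => lam n / eta n) atTop (𝓝 ρ₀)) :
    TendstoInMeasure P ((fun n ω => √(m n : ℝ) • (βhat n ω - β)) -
      fun n ω => √(m n : ℝ) • (βinit n ω - β)) atTop 0 := by
  refine tendstoInMeasure_zero_of_forall_bounded hV fun K δ hδ => ?_
  have hinv : Tendsto (fun n : ℕ => √(n : ℝ) / eta n) atTop (𝓝 0) := by
    simpa only [Pi.inv_def, inv_div] using h1.inv_tendsto_atTop
  -- The hypothesis of `eq_center_of_localObjective_le` divided by `eta * √m / n`: the left side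
  -- tends to `0` and the right side to `1 - ρ₀ > 0`.
  have hlhs : Tendsto (fun n : ℕ => 2 * (√(n : ℝ) / eta n * K) +
      2 * (‖gramOperator (X n)‖ * (√((n : ℝ) / m n) * (√(n : ℝ) / eta n) * K))) atTop (𝓝 0) := by
    simpa using ((hinv.mul_const K).const_mul 2).add
      ((hAn.norm.mul ((hr₀.sqrt.mul hinv).mul_const K)).const_mul 2)
  have hrhs : Tendsto (fun n => 1 - lam n / eta n) atTop (𝓝 (1 - ρ₀)) := h2.const_sub 1
  filter_upwards [hlhs.eventually_lt hrhs (by linarith), hm, eventually_gt_atTop 0,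
    h1.eventually_gt_atTop 0] with n h3 h4 h5 h6 ω hω
  have hn : 0 < √(n : ℝ) := Real.sqrt_pos.2 (Nat.cast_pos.2 h5)
  have hm' : 0 < √(m n : ℝ) := Real.sqrt_pos.2 (Nat.cast_pos.2 h4)
  have hn2 : (n : ℝ) = √(n : ℝ) * √(n : ℝ) := (Real.mul_self_sqrt n.cast_nonneg).symm
  have heta : 0 < eta n := (div_pos_iff_of_pos_right hn).1 h6
  have hw : ‖normalizedScore (X n) (ε n ω)‖ ≤ K := (norm_fst_le _).trans hω
  have hd : ‖√(m n : ℝ) • (βinit n ω - β)‖ ≤ K := (norm_snd_le _).trans hω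
  have key := eq_center_of_localObjective_le (A := gramOperator (X n))
    (φ := lassoIncrement β √(m n : ℝ)) (a := lam n * √(m n : ℝ) / n) (b := eta n * √(m n : ℝ) / n)
    (w := (√(m n : ℝ) / √(n : ℝ)) • normalizedScore (X n) (ε n ω))
    (fun v => by rw [inner_gramOperator]; positivity) (isPenalty_lassoIncrement β _)
    (div_nonneg (mul_nonneg (hlam n) hm'.le) n.cast_nonneg) ?_
    ((hmin n ω).localObjective_le h5 hm' (√(m n : ℝ) • (βinit n ω - β)))
  · simp only [Pi.sub_apply, key, sub_self, norm_zero, hδ]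
  · have h7 := mul_lt_mul_of_pos_right h3 (by positivity : 0 < eta n * √(m n : ℝ) / n)
    rw [Real.sqrt_div n.cast_nonneg] at h7
    have e1 : (2 * (√(n : ℝ) / eta n * K) + 2 * (‖gramOperator (X n)‖ *
        (√(n : ℝ) / √(m n : ℝ) * (√(n : ℝ) / eta n) * K))) * (eta n * √(m n : ℝ) / n) =
        2 * (√(m n : ℝ) / √(n : ℝ) * K) + 2 * ‖gramOperator (X n)‖ * K := by
      rw [hn2]
      simp only [Real.sqrt_mul_self hn.le]
      field_simp
    have e2 : (1 - lam n / eta n) * (eta n * √(m n : ℝ) / n) =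
        eta n * √(m n : ℝ) / n - lam n * √(m n : ℝ) / n := by
      field_simp
    rw [e1, e2] at h7
    refine h7.trans_le' ?_
    rw [norm_smul, Real.norm_of_nonneg (by positivity)]
    gcongr

end Domination

end

/-! ### The three regimes -/

theorem mainTheorem6
    {Ω : Type*} [MeasurableSpace Ω] (P : Measure Ω) [IsProbabilityMeasure P]
    (p : ℕ) (hp : 0 < p)
    -- target data: design, Gaussian noise, true parameter
    (X : (n : ℕ) → Matrix (Fin n) (Fin p) ℝ) (hX : DesignCondition X)
    (σ : ℝ≥0) (hσ : 0 < σ)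
    (ε : (n : ℕ) → Ω → Fin n → ℝ)
    (hε : ∀ n, HasLaw (ε n) (Measure.pi fun _ : Fin n => gaussianReal 0 (σ ^ 2)) P)
    (βstar : EuclideanSpace ℝ (Fin p))
    -- source data: sample size `m n`, initial estimator, limit law `ν` of its scaled error
    (m : ℕ → ℕ) (hm : ∀ᶠ n in atTop, 0 < m n)
    (r₀ : ℝ) (hr₀ : Tendsto (fun n : ℕ => (n : ℝ) / (m n : ℝ)) atTop (𝓝 r₀))
    (βinit : ℕ → Ω → EuclideanSpace ℝ (Fin p))
    (hβinit : ∀ n, AEMeasurable (βinit n) P)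
    (ν : Measure (EuclideanSpace ℝ (Fin p))) [IsProbabilityMeasure ν]
    (hz : TendstoInDistribution (fun n ω => √(m n : ℝ) • (βinit n ω - βstar)) atTop id
      (fun _ => P) ν)
    (hindep : ∀ n, IndepFun (βinit n) (ε n) P)
    -- regularisation parameters and the Transfer Lasso estimator
    (lam eta : ℕ → ℝ) (hlam : ∀ n, 0 ≤ lam n) (heta : ∀ n, 0 ≤ eta n)
    (βhat : ℕ → Ω → EuclideanSpace ℝ (Fin p))
    (hβhat : ∀ n, AEMeasurable (βhat n) P)
    (hmin : ∀ n ω, IsTransferLasso (X n) (X n *ᵥ βstar.ofLp + ε n ω) (lam n) (eta n)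
      (βinit n ω) (βhat n ω)) :
    -- (i)
    (∀ ρ₀ : ℝ, 0 ≤ ρ₀ → ρ₀ < 1 →
      Tendsto (fun n : ℕ => eta n / √(n : ℝ)) atTop atTop →
      Tendsto (fun n : ℕ => lam n / eta n) atTop (𝓝 ρ₀) →
      ConvergesAtRate P (fun n ω => βhat n ω - βstar) (fun n => √(m n : ℝ)) ∧
      (ν ≠ Measure.dirac 0 →
        HasConvergenceRate P (fun n ω => βhat n ω - βstar) (fun n => √(m n : ℝ)))) ∧
    -- (ii)
    (∀ lam₀ eta₀ : ℝ, 0 ≤ lam₀ → 0 ≤ eta₀ →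
      Tendsto (fun n : ℕ => lam n / √(n : ℝ)) atTop (𝓝 lam₀) →
      Tendsto (fun n : ℕ => eta n / √(n : ℝ)) atTop (𝓝 eta₀) →
      HasConvergenceRate P (fun n ω => βhat n ω - βstar) (fun n => √(n : ℝ))) ∧
    -- (iii)
    (∀ ρ₀' : ℝ, 0 ≤ ρ₀' →
      Tendsto (fun n : ℕ => lam n / √(n : ℝ)) atTop atTop →
      Tendsto (fun n : ℕ => lam n / (n : ℝ)) atTop (𝓝 0) →
      Tendsto (fun n : ℕ => eta n / lam n) atTop (𝓝 ρ₀') →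
      (ρ₀' < 1 →
        ConvergesAtRate P (fun n ω => βhat n ω - βstar) (fun n => (n : ℝ) / lam n) ∧
        (fun n : ℕ => (n : ℝ) / lam n) =o[atTop] (fun n : ℕ => √(n : ℝ)) ∧
        (βstar ≠ 0 →
          HasConvergenceRate P (fun n ω => βhat n ω - βstar) (fun n => (n : ℝ) / lam n) ∧
          ¬ IsBoundedInProbability P (fun n ω => √(n : ℝ) • (βhat n ω - βstar)))) ∧
      (1 ≤ ρ₀' →
        HasRateFasterThan P (fun n ω => βhat n ω - βstar) (fun n => (n : ℝ) / lam n))) := by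
  obtain ⟨⟨C, hC, hXC⟩, -⟩ := hX
  have hAn := tendsto_gramOperator hXC
  obtain ⟨c, hc, hA⟩ := hC.exists_coercive
  have hW := tendstoInDistribution_normalizedScore hC hAn hε
  have hσC : ((σ : ℝ) ^ 2 • C).PosDef := hC.smul (by positivity)
  have hV := tendstoInDistribution_prodMk_of_indepFun hW hz fun n =>
    ((hindep n).symm.comp (continuous_normalizedScore (X n)).measurable
      ((measurable_id.sub_const βstar).const_smul √(m n : ℝ)))
  have hsqrt : Tendsto (fun n : ℕ => √(n : ℝ)) atTop atTop :=
    Real.tendsto_sqrt_atTop.comp tendsto_natCast_atTop_atTop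
  have hratio : Tendsto (fun n : ℕ => √(n : ℝ) / √(m n : ℝ)) atTop (𝓝 √r₀) := by
    simpa only [Real.sqrt_div (Nat.cast_nonneg _)] using hr₀.sqrt
  refine ⟨fun ρ₀ _ hρ₀ h1 h2 => ?_, fun lam₀ eta₀ hlam₀ heta₀ h1 h2 => ?_,
    fun ρ hρ h1 h2 h3 => ?_⟩
  · have hlim := tendstoInDistribution_of_tendstoInMeasure_sub _ _ hz
      (tendstoInMeasure_transferLasso_sub_init hm hr₀ hlam hmin hV hAn hρ₀ h1 h2)
      fun n => ((hβhat n).sub_const βstar).const_smul √(m n : ℝ)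
    exact ⟨⟨⟨ν, inferInstance⟩, hlim⟩, fun hν => ⟨⟨ν, inferInstance⟩, hlim, hν⟩⟩
  · obtain ⟨F, hF, hFmin⟩ := exists_continuous_localObjective_minimiser hc hA
      (isPenalty_lassoSlope βstar) hlam₀ heta₀
    have hdiv : ∀ x : ℝ, ∀ n : ℕ, x * √(n : ℝ) / n = x / √(n : ℝ) := fun x n => by
      rw [mul_div_assoc, Real.sqrt_div_self, div_eq_mul_inv]
    have hκ : Tendsto (fun n : ℕ => √(n : ℝ) / √(n : ℝ)) atTop (𝓝 1) :=
      tendsto_const_nhds.congr' ((hsqrt.eventually_gt_atTop 0).mono fun n hn =>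
        (div_self hn.ne').symm)
    have hlim := tendstoInDistribution_smul_transferLasso hm hlam heta hβhat hmin hV hAn hc hA
      hsqrt hκ hratio (by simpa only [hdiv] using h1) (by simpa only [hdiv] using h2)
      hlam₀ heta₀ hF hFmin
    -- If the limit vanished almost surely, `0` would minimise the limit objective and bound its
    -- linear term, a nondegenerate Gaussian.
    refine hasConvergenceRate_of_tendstoInDistribution hlim fun hzero => ?_
    refine not_ae_norm_le_multivariateGaussian hp hσC ((lam₀ + eta₀) * p) ?_
    have h4 : ∀ᵐ x ∂((multivariateGaussian 0 ((σ : ℝ) ^ 2 • C)).prod ν),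
        ‖x.1‖ ≤ (lam₀ + eta₀) * p := by
      filter_upwards [hzero] with x hx
      have h5 := hFmin ((1 : ℝ) • x.1, √r₀ • x.2)
      rw [hx, one_smul] at h5
      exact norm_le_of_zero_minimiser hlam₀ heta₀ (isPenalty_lassoSlope βstar) h5
    rw [← (measurePreserving_fst (μ := multivariateGaussian 0 ((σ : ℝ) ^ 2 • C)) (ν := ν)).map_eq]
    exact (ae_map_iff measurable_fst.aemeasurable
      (isClosed_le continuous_norm continuous_const).measurableSet).2 h4
  · obtain ⟨F, hF, hFmin⟩ := exists_continuous_localObjective_minimiser hc hA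
      (isPenalty_lassoSlope βstar) zero_le_one hρ
    have hpos : ∀ᶠ n : ℕ in atTop, 0 < √(n : ℝ) ∧ 0 < lam n := by
      filter_upwards [hsqrt.eventually_gt_atTop 0, h1.eventually_gt_atTop 0] with n hn hn'
      exact ⟨hn, (div_pos_iff_of_pos_right hn).1 hn'⟩
    have hinv : Tendsto (fun n : ℕ => √(n : ℝ) / lam n) atTop (𝓝 0) := by
      simpa only [Pi.inv_def, inv_div] using h1.inv_tendsto_atTop
    have hκ : Tendsto (fun n : ℕ => (n : ℝ) / lam n / √(n : ℝ)) atTop (𝓝 0) := by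
      refine hinv.congr' (hpos.mono fun n hn => ?_)
      change √(n : ℝ) / lam n = (n : ℝ) / lam n / √(n : ℝ)
      rw [div_right_comm, Real.div_sqrt]
    have hs : Tendsto (fun n : ℕ => (n : ℝ) / lam n) atTop atTop := by
      have : Tendsto (fun n : ℕ => lam n / (n : ℝ)) atTop (𝓝[>] 0) :=
        tendsto_nhdsWithin_iff.2 ⟨h2, hpos.mono fun n hn =>
          div_pos hn.2 (Real.sqrt_pos.1 hn.1)⟩
      simpa only [Pi.inv_def, inv_div] using this.inv_tendsto_nhdsGT_zero
    have hκ' : Tendsto (fun n : ℕ => (n : ℝ) / lam n / √(m n : ℝ)) atTop (𝓝 0) := by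
      have h4 := hκ.mul hratio
      rw [zero_mul] at h4
      refine h4.congr' (hpos.mono fun n hn => ?_)
      exact div_mul_div_cancel₀ hn.1.ne'
    have ha : Tendsto (fun n : ℕ => lam n * ((n : ℝ) / lam n) / n) atTop (𝓝 1) := by
      refine tendsto_const_nhds.congr' (hpos.mono fun n hn => ?_)
      have h4 := hn.2.ne'
      have h5 := (Real.sqrt_pos.1 hn.1).ne'
      field_simp
    have hb : Tendsto (fun n : ℕ => eta n * ((n : ℝ) / lam n) / n) atTop (𝓝 ρ) := by
      refine h3.congr' (hpos.mono fun n hn => ?_)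
      have h5 := (Real.sqrt_pos.1 hn.1).ne'
      field_simp
    have hlim := tendstoInDistribution_smul_transferLasso hm hlam heta hβhat hmin hV hAn hc hA
      hs hκ hκ' ha hb zero_le_one hρ hF hFmin
    -- Both inputs enter with limiting factor `0`, so the limit is the constant `F (0, 0)` and
    -- convergence holds in probability.
    simp only [zero_smul] at hlim
    have hmeas := tendstoInMeasure_of_tendstoInDistribution_const hlim
    refine ⟨fun hρ1 => ⟨convergesAtRate_of_tendstoInDistribution hlim, ?_, fun hβ => ?_⟩,
      fun hρ1 => ?_⟩
    · exact (Asymptotics.isLittleO_iff_tendsto' (hpos.mono fun n hn h => absurd h hn.1.ne')).2 hκ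
    · have hne := localObjective_minimiser_ne_zero hβ hρ1 (hFmin (0, 0))
      refine ⟨hasConvergenceRate_of_tendstoInDistribution hlim (by simpa using hne),
        not_isBoundedInProbability_of_tendstoInMeasure hne hmeas h1 (hpos.mono fun n hn ω => ?_)⟩
      -- `√n = (lam / √n) * (n / lam)`, and the first factor diverges.
      rw [smul_smul]
      congr 1
      have h4 := hn.1.ne'
      have h5 := hn.2.ne'
      rw [div_mul_div_comm, mul_comm, mul_div_mul_right _ _ h5, Real.div_sqrt]
    · have h0 := localObjective_minimiser_eq_zero hc hA (isPenalty_lassoSlope βstar) hρ1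
        (hFmin (0, 0) 0)
      rw [h0] at hmeas
      exact hmeas
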